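/- For real $\nu$ and $x>0$ let $$J_\nu(x)=\sum_{n\ge 0}\frac{(-1)^n}{n!\,\Gamma(n+\nu+1)}\Big(\frac x2\Big)^{2n+\nu}$$ (with $1/\Gamma=0$ at the poles of $\Gamma$) be the Bessel function of the first kind, and let $$Y_\nu(x)=\frac{J_\nu(x)\cos(\nu\pi)-J_{-\nu}(x)}{\sin(\nu\pi)}$$ be the Bessel function of the second kind, where for integer $\nu$ the right-hand side is replaced by its limit as the order tends to $\nu$. Let $\nu>1$. The equation $Y_\nu^2(x)-Y_{\nu-1}(x)Y_{\nu+1}(x)=0$ has exactly one root $x_\nu$ in $(0,\infty)$, and $x_\nu\le\nu$. Moreover: (a) $Y_\nu^2(x)-Y_{\nu-1}(x)Y_{\nu+1}(x)>0$ for all $x>x_\nu$; (b) $Y_\nu^2(x)-Y_{\nu-1}(x)Y_{\nu+1}(x)<0$ for all $0<x<x_\nu$; (c) $Y_\nu^2(x)-Y_{\nu-1}(x)Y_{\nu+1}(x)>\frac{1}{1-\nu}Y_\nu^2(x)$ for all $x\ge x_\nu$, and on this range the constant $\frac1{1-\nu}$ is not the best possible: there is a constant $c>\frac1{1-\nu}$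 (depending only on $\nu$) such that $Y_\nu^2(x)-Y_{\nu-1}(x)Y_{\nu+1}(x)>c\,Y_\nu^2(x)$ for all $x\ge x_\nu$. -/

import Mathlib

open Filter Topology

/-- The Bessel function of the first kind of real order `ν`, for `x > 0`, by its power series.
At the poles of `Γ`, Mathlib's `Real.Gamma` is `0`, and Lean's `a / 0 = 0` gives the usual
convention `1 / Γ(-k) = 0`. -/
noncomputable def besselJ (ν x : ℝ) : ℝ :=
  ∑' n : ℕ, (-1 : ℝ) ^ n / ((n.factorial : ℝ) * Real.Gamma ((n : ℝ) + ν + 1)) *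
    (x / 2) ^ (2 * (n : ℝ) + ν)

/-- The quotient defining the Bessel function of the second kind at a non-integer order. -/
noncomputable def besselYQuot (ν x : ℝ) : ℝ :=
  (besselJ ν x * Real.cos (ν * Real.pi) - besselJ (-ν) x) / Real.sin (ν * Real.pi)

open Classical in
/-- The Bessel function of the second kind of real order `ν`, for `x > 0`; at an integer order
the quotient is replaced by its limit as the order tends to that integer. -/
noncomputable def besselY (ν x : ℝ) : ℝ :=
  if ∃ k : ℤ, ν = (k : ℝ) then limUnder (𝓝[≠] ν) (fun μ : ℝ => besselYQuot μ x)
  else besselYQuot ν x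

/-- The Turán expression `Y_ν(x)² - Y_{ν-1}(x) Y_{ν+1}(x)`. -/
noncomputable def turanY (ν x : ℝ) : ℝ :=
  besselY ν x ^ 2 - besselY (ν - 1) x * besselY (ν + 1) x

/-! Write Δ for the Turán expression. The contiguous relations for Y give (x²Δ)' = 2xY_ν² ≥ 0, so
x²Δ increases and Δ changes sign at most once (`hasDerivAt_sq_mul_turanY`). Growth is strict: on an
interval where Y_ν vanishes, Y_{ν+1} would vanish too, which `energy_pos` excludes. Near 0, Y_ν(2t)
~ -Γ(ν)/(π t^ν), and Γ(ν)² < Γ(ν-1)Γ(ν+1) makes Δ negative (`exists_turanY_neg`). At x = ν, Δ is the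
perfect square (Y_ν - Y_{ν+1})². The intermediate value theorem then gives the root x_ν ≤ ν.

For (c), Δ ≥ 0 on [x_ν, ∞) and Y_ν(x_ν) ≠ 0, so every negative constant works there.

Most of the work is calculus for Y, above all at integer orders. There Y is expressed through the
derivative of J in its order, which exists because J_μ(x) = (x/2)^μ A_μ(x²/4) with Taylor
coefficients built from the entire function 1/Γ. -/

/-! ### The reciprocal Gamma function -/

/-- The reciprocal Gamma function `μ ↦ 1 / Γ(μ + 1)` on the real line. -/
noncomputable def rGamma (μ : ℝ) : ℝ := (Real.Gamma (μ + 1))⁻¹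

theorem contDiff_rGamma (n : WithTop ℕ∞) : ContDiff ℝ n rGamma := by
  have h : ContDiff ℂ n fun s : ℂ => (Complex.Gamma s)⁻¹ :=
    Complex.differentiable_one_div_Gamma.contDiff
  have h2 : ContDiff ℝ n fun μ : ℝ => Complex.reCLM ((Complex.Gamma (Complex.ofRealCLM (μ + 1)))⁻¹) :=
    Complex.reCLM.contDiff.comp ((h.restrict_scalars ℝ).comp
      (Complex.ofRealCLM.contDiff.comp (contDiff_id.add contDiff_const)))
  convert h2 using 2 with μ
  simp only [rGamma, Complex.ofRealCLM_apply, Complex.Gamma_ofReal, Complex.reCLM_apply]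
  rw [← Complex.ofReal_inv, Complex.ofReal_re]

theorem rGamma_recurrence (μ : ℝ) : rGamma μ = (μ + 1) * rGamma (μ + 1) := by
  unfold rGamma
  rcases eq_or_ne (μ + 1) 0 with h | h
  -- At the pole both sides are 0, since `Real.Gamma 0 = 0` and `0⁻¹ = 0`.
  · simp [h]
  · rw [Real.Gamma_add_one h, mul_inv]
    field_simp

theorem hasDerivAt_rGamma (μ : ℝ) : HasDerivAt rGamma (deriv rGamma μ) μ :=
  ((contDiff_rGamma 1).differentiable (by norm_num) μ).hasDerivAt

theorem deriv_rGamma_recurrence (μ : ℝ) :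
    deriv rGamma μ = rGamma (μ + 1) + (μ + 1) * deriv rGamma (μ + 1) := by
  have h1 : HasDerivAt (fun t : ℝ => (t + 1) * rGamma (t + 1))
      (1 * rGamma (μ + 1) + (μ + 1) * deriv rGamma (μ + 1)) μ :=
    ((hasDerivAt_id μ).add_const 1).mul ((hasDerivAt_rGamma (μ + 1)).comp_add_const μ 1)
  have h2 : (fun t : ℝ => (t + 1) * rGamma (t + 1)) = rGamma :=
    funext fun t => (rGamma_recurrence t).symm
  rw [h2] at h1
  rw [h1.deriv, one_mul]

theorem rGamma_nat (n : ℕ) : rGamma n = (n.factorial : ℝ)⁻¹ := by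
  rw [rGamma, Real.Gamma_nat_eq_factorial]

theorem rGamma_neg_nat (n : ℕ) : rGamma (-((n : ℝ) + 1)) = 0 := by
  have h : -((n : ℝ) + 1) + 1 = -(n : ℝ) := by ring
  rw [rGamma, h, Real.Gamma_neg_nat_eq_zero, inv_zero]

/-- At a zero of 1/Γ only the product term of the differentiated recurrence survives. These values
give the leading term at 0 of Y of integer order. -/
theorem deriv_rGamma_neg_nat (n : ℕ) :
    deriv rGamma (-((n : ℝ) + 1)) = (-1) ^ n * (n.factorial : ℝ) := by
  induction n with
  | zero =>
    rw [deriv_rGamma_recurrence]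
    have := rGamma_nat 0
    simp at this
    simp [this]
  | succ k ih =>
    rw [deriv_rGamma_recurrence]
    have h : -(((k + 1 : ℕ) : ℝ) + 1) + 1 = -((k : ℝ) + 1) := by push_cast; ring
    rw [h, ih, rGamma_neg_nat, Nat.factorial_succ]
    push_cast
    ring

/-- Compactness gives the bound up to 2. Beyond 2 the recurrences divide by μ ≥ 2, which absorbs the
sum of two terms in the one for the derivative, so the same M persists. -/
theorem exists_bound_rGamma (c : ℝ) :
    ∃ M : ℝ, ∀ μ, c ≤ μ → |rGamma μ| ≤ M ∧ |deriv rGamma μ| ≤ M := by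
  obtain ⟨M₁, h₁⟩ := (isCompact_Icc (a := min c 1) (b := 2)).exists_bound_of_continuousOn
    (contDiff_rGamma 0).continuous.continuousOn
  obtain ⟨M₂, h₂⟩ := (isCompact_Icc (a := min c 1) (b := 2)).exists_bound_of_continuousOn
    ((contDiff_rGamma 1).continuous_deriv le_rfl).continuousOn
  simp only [Real.norm_eq_abs] at h₁ h₂
  refine ⟨max M₁ M₂, ?_⟩
  set M := max M₁ M₂
  have key : ∀ n : ℕ, ∀ μ ∈ Set.Icc (min c 1) (2 + n),
      |rGamma μ| ≤ M ∧ |deriv rGamma μ| ≤ M := by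
    intro n
    induction n with
    | zero =>
      intro μ hμ
      have hμ' : μ ∈ Set.Icc (min c 1) 2 := by simpa using hμ
      exact ⟨(h₁ μ hμ').trans (le_max_left _ _), (h₂ μ hμ').trans (le_max_right _ _)⟩
    | succ n ih =>
      intro μ hμ
      by_cases h : μ ≤ 2 + n
      · exact ih μ ⟨hμ.1, h⟩
      push Not at h
      have hn : (0 : ℝ) ≤ n := n.cast_nonneg
      have hμ2 : 2 ≤ μ := by linarith
      have hm : μ - 1 ∈ Set.Icc (min c 1) (2 + n) := by
        refine ⟨(min_le_right _ _).trans (by linarith), ?_⟩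
        have := hμ.2
        push_cast at this
        linarith
      obtain ⟨i₁, i₂⟩ := ih _ hm
      have e₁ := rGamma_recurrence (μ - 1)
      have e₂ := deriv_rGamma_recurrence (μ - 1)
      rw [sub_add_cancel] at e₁ e₂
      rw [e₁, abs_mul, abs_of_nonneg (by linarith : 0 ≤ μ)] at i₁
      have b₁ : |rGamma μ| ≤ M := by nlinarith [abs_nonneg (rGamma μ)]
      refine ⟨b₁, ?_⟩
      have e₃ : μ * deriv rGamma μ = deriv rGamma (μ - 1) - rGamma μ := by rw [e₂]; ring
      have b₃ : |μ * deriv rGamma μ| ≤ 2 * M := by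
        rw [e₃]
        exact (abs_sub _ _).trans (by linarith)
      rw [abs_mul, abs_of_nonneg (by linarith : 0 ≤ μ)] at b₃
      nlinarith [abs_nonneg (deriv rGamma μ)]
  intro μ hμ
  obtain ⟨n, hn⟩ := exists_nat_ge (μ - 2)
  exact key n μ ⟨(min_le_left _ _).trans hμ, by linarith⟩

/-! ### Alternating exponential generating functions -/

/-- The alternating exponential generating function `∑ c n (-y)^n / n!`. -/
noncomputable def altEGF (c : ℕ → ℝ) (y : ℝ) : ℝ :=
  ∑' n : ℕ, c n * ((-y) ^ n / (n.factorial : ℝ))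

theorem summable_altEGF {c : ℕ → ℝ} {M : ℝ} (hc : ∀ n, |c n| ≤ M) (y : ℝ) :
    Summable fun n : ℕ => c n * ((-y) ^ n / (n.factorial : ℝ)) := by
  refine Summable.of_norm_bounded (g := fun n : ℕ => M * (|y| ^ n / (n.factorial : ℝ)))
    ((Real.summable_pow_div_factorial |y|).mul_left M) fun n => ?_
  rw [Real.norm_eq_abs, abs_mul, abs_div, abs_pow, abs_neg, Nat.abs_cast]
  exact mul_le_mul_of_nonneg_right (hc n) (by positivity)

theorem succ_mul_pow_div_factorial (y : ℝ) (n : ℕ) :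
    ((n + 1 : ℕ) : ℝ) * y ^ n / ((n + 1).factorial : ℝ) = y ^ n / (n.factorial : ℝ) := by
  rw [Nat.factorial_succ]
  push_cast
  have : (n.factorial : ℝ) ≠ 0 := by positivity
  field_simp

theorem hasSum_altEGF {c : ℕ → ℝ} {M : ℝ} (hc : ∀ n, |c n| ≤ M) (y : ℝ) :
    HasSum (fun n : ℕ => c n * ((-y) ^ n / (n.factorial : ℝ))) (altEGF c y) :=
  (summable_altEGF hc y).hasSum

theorem hasSum_deriv_altEGF {c : ℕ → ℝ} {M : ℝ} (hc : ∀ n, |c n| ≤ M) (y : ℝ) :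
    HasSum (fun n : ℕ => c n * ((n : ℝ) * (-y) ^ (n - 1) * (-1) / (n.factorial : ℝ)))
      (-altEGF (fun n => c (n + 1)) y) := by
  refine (hasSum_nat_add_iff' 1).1 ?_
  simp only [Finset.range_one, Finset.sum_singleton, Nat.cast_zero, zero_mul, zero_div, mul_zero,
    sub_zero, Nat.add_sub_cancel]
  convert (hasSum_altEGF (c := fun n => c (n + 1)) (fun n => hc (n + 1)) y).neg using 2 with n
  rw [← succ_mul_pow_div_factorial]
  ring

theorem hasDerivAt_altEGF {c : ℕ → ℝ} {M : ℝ} (hc : ∀ n, |c n| ≤ M) (y : ℝ) :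
    HasDerivAt (altEGF c) (-altEGF (fun n => c (n + 1)) y) y := by
  set R := |y| + 1
  have hM : 0 ≤ M := (abs_nonneg _).trans (hc 0)
  have hu : Summable fun n : ℕ => M * ((n : ℝ) * R ^ (n - 1) / (n.factorial : ℝ)) := by
    refine Summable.mul_left M ((summable_nat_add_iff 1).1 ?_)
    simp only [Nat.add_sub_cancel, succ_mul_pow_div_factorial]
    exact Real.summable_pow_div_factorial R
  have hd : ∀ (n : ℕ) (t : ℝ), HasDerivAt (fun t => c n * ((-t) ^ n / (n.factorial : ℝ)))
      (c n * ((n : ℝ) * (-t) ^ (n - 1) * (-1) / (n.factorial : ℝ))) t := fun n t =>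
    (((hasDerivAt_id t).neg.fun_pow n).div_const _).const_mul _
  have hy : y ∈ Set.Ioo (-R) R := by
    constructor
    · linarith [neg_abs_le y]
    · linarith [le_abs_self y]
  have h := hasDerivAt_tsum_of_isPreconnected hu isOpen_Ioo isPreconnected_Ioo
    (fun n t _ => hd n t) (fun n t ht => ?_) hy (summable_altEGF hc y) hy
  · rw [← (hasSum_deriv_altEGF hc y).tsum_eq]
    exact h
  · rw [Real.norm_eq_abs, abs_mul, abs_div, abs_mul, abs_mul, abs_pow, abs_neg, Nat.abs_cast,
      Nat.abs_cast, abs_neg, abs_one, mul_one]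
    have ht' : |t| ≤ R := abs_le.2 ⟨ht.1.le, ht.2.le⟩
    gcongr
    exact hc n

theorem altEGF_zero (c : ℕ → ℝ) : altEGF c 0 = c 0 := by
  rw [altEGF, tsum_eq_single 0]
  · simp
  · intro n hn
    simp [hn]

/-- This is the Euler operator y d/dy; it supplies the factor n in the three-term recurrences. -/
theorem hasSum_nat_mul_altEGF {c : ℕ → ℝ} {M : ℝ} (hc : ∀ n, |c n| ≤ M) (y : ℝ) :
    HasSum (fun n : ℕ => (n : ℝ) * c n * ((-y) ^ n / (n.factorial : ℝ)))
      (-y * altEGF (fun n => c (n + 1)) y) := by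
  rw [show ∀ S : ℝ, -y * S = y * -S from fun S => by ring]
  refine (congrArg (HasSum · _) (funext fun n => ?_)).mp ((hasSum_deriv_altEGF hc y).mul_left y)
  rcases n with _ | n
  · simp
  · simp only [Nat.add_sub_cancel]
    ring

/-! ### The entire factor of J and its derivative in the order -/

/-- The entire factor of the Bessel function: `J_μ(x) = (x/2)^μ * besselA μ (x²/4)`. -/
noncomputable def besselA (μ y : ℝ) : ℝ := altEGF (fun n => rGamma (n + μ)) y

/-- The derivative of `besselA μ y` in the order `μ`. -/
noncomputable def besselB (μ y : ℝ) : ℝ := altEGF (fun n => deriv rGamma (n + μ)) y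

theorem exists_bound_coeff (c : ℝ) : ∃ M : ℝ, ∀ μ, c ≤ μ → ∀ n : ℕ,
    |rGamma (n + μ)| ≤ M ∧ |deriv rGamma (n + μ)| ≤ M := by
  obtain ⟨M, hM⟩ := exists_bound_rGamma c
  refine ⟨M, fun μ hμ n => hM _ ?_⟩
  have : (0 : ℝ) ≤ n := n.cast_nonneg
  linarith

theorem besselA_add_one (μ y : ℝ) :
    besselA (μ + 1) y = altEGF (fun n => rGamma ((n + 1 : ℕ) + μ)) y := by
  unfold besselA
  congr 1
  funext n
  push_cast
  congr 1
  ring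

theorem besselB_add_one (μ y : ℝ) :
    besselB (μ + 1) y = altEGF (fun n => deriv rGamma ((n + 1 : ℕ) + μ)) y := by
  unfold besselB
  congr 1
  funext n
  push_cast
  congr 1
  ring

theorem hasDerivAt_besselA (μ y : ℝ) : HasDerivAt (besselA μ) (-besselA (μ + 1) y) y := by
  obtain ⟨M, hM⟩ := exists_bound_coeff μ
  rw [besselA_add_one]
  exact hasDerivAt_altEGF (fun n => (hM μ le_rfl n).1) y

theorem hasDerivAt_besselB (μ y : ℝ) : HasDerivAt (besselB μ) (-besselB (μ + 1) y) y := by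
  obtain ⟨M, hM⟩ := exists_bound_coeff μ
  rw [besselB_add_one]
  exact hasDerivAt_altEGF (fun n => (hM μ le_rfl n).2) y

/-- Coefficientwise this is `rGamma_recurrence` with factor n + μ: the μ gives the right-hand side,
the n gives the Euler operator. -/
theorem besselA_recurrence (μ y : ℝ) :
    besselA (μ - 1) y + y * besselA (μ + 1) y = μ * besselA μ y := by
  obtain ⟨M, hM⟩ := exists_bound_coeff (μ - 1)
  have h0 := hasSum_altEGF (fun n => (hM (μ - 1) le_rfl n).1) y
  have h1 := hasSum_altEGF (fun n => (hM μ (by linarith) n).1) y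
  have h2 := hasSum_nat_mul_altEGF (fun n => (hM μ (by linarith) n).1) y
  have h3 := h0.unique ((congrArg (HasSum · _) (funext fun n => ?_)).mp ((h1.mul_left μ).add h2))
  · rw [besselA_add_one]
    simp only [besselA]
    rw [h3]
    ring
  · have e := rGamma_recurrence (n + (μ - 1))
    rw [show (n : ℝ) + (μ - 1) + 1 = n + μ by ring] at e
    rw [e]
    ring

theorem besselB_recurrence (μ y : ℝ) :
    besselB (μ - 1) y + y * besselB (μ + 1) y = μ * besselB μ y + besselA μ y := by
  obtain ⟨M, hM⟩ := exists_bound_coeff (μ - 1)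
  have hA := hasSum_altEGF (fun n => (hM μ (by linarith) n).1) y
  have h0 := hasSum_altEGF (fun n => (hM (μ - 1) le_rfl n).2) y
  have h1 := hasSum_altEGF (fun n => (hM μ (by linarith) n).2) y
  have h2 := hasSum_nat_mul_altEGF (fun n => (hM μ (by linarith) n).2) y
  have h3 := h0.unique ((congrArg (HasSum · _) (funext fun n => ?_)).mp (((h1.mul_left μ).add h2).add hA))
  · rw [besselB_add_one]
    simp only [besselA, besselB]
    rw [h3]
    ring
  · have e := deriv_rGamma_recurrence (n + (μ - 1))
    rw [show (n : ℝ) + (μ - 1) + 1 = n + μ by ring] at e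
    rw [e]
    ring

theorem hasDerivAt_besselA_order (μ y : ℝ) :
    HasDerivAt (fun t => besselA t y) (besselB μ y) μ := by
  obtain ⟨M, hM⟩ := exists_bound_coeff (μ - 1)
  have hμ : μ ∈ Set.Ioi (μ - 1) := by simp
  refine hasDerivAt_tsum_of_isPreconnected
    ((Real.summable_pow_div_factorial |y|).mul_left M) isOpen_Ioi isPreconnected_Ioi
    (fun n t _ => ((hasDerivAt_rGamma (n + t)).comp_const_add (n : ℝ) t).mul_const _)
    (fun n t ht => ?_) hμ (summable_altEGF (fun n => (hM μ (by linarith) n).1) y) hμ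
  rw [Real.norm_eq_abs, abs_mul, abs_div, abs_pow, abs_neg, Nat.abs_cast]
  exact mul_le_mul_of_nonneg_right (hM t (le_of_lt ht) n).2 (by positivity)

/-! ### J and its order derivative K: recurrences and derivatives -/

theorem besselJ_eq (μ : ℝ) {x : ℝ} (hx : 0 < x) :
    besselJ μ x = (x / 2) ^ μ * besselA μ (x ^ 2 / 4) := by
  unfold besselJ besselA altEGF
  rw [← tsum_mul_left]
  refine tsum_congr fun n => ?_
  have h2 : (0 : ℝ) < x / 2 := by positivity
  rw [Real.rpow_add h2, show (2 * (n : ℝ)) = ((2 * n : ℕ) : ℝ) by push_cast; ring,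
    Real.rpow_natCast, pow_mul, show (x / 2) ^ 2 = x ^ 2 / 4 by ring, neg_pow (x ^ 2 / 4)]
  simp only [rGamma]
  ring

/-- The derivative of `J_μ(x)` in the order `μ`. -/
noncomputable def besselK (μ x : ℝ) : ℝ :=
  (x / 2) ^ μ * (Real.log (x / 2) * besselA μ (x ^ 2 / 4) + besselB μ (x ^ 2 / 4))

theorem hasDerivAt_besselJ_order (μ : ℝ) {x : ℝ} (hx : 0 < x) :
    HasDerivAt (fun t => besselJ t x) (besselK μ x) μ := by
  have h2 : (0 : ℝ) < x / 2 := by positivity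
  have h := ((Real.hasStrictDerivAt_const_rpow h2 μ).hasDerivAt).mul
    (hasDerivAt_besselA_order μ (x ^ 2 / 4))
  simp only [funext fun t => besselJ_eq t hx]
  refine HasDerivAt.congr_deriv h ?_
  unfold besselK
  ring

theorem rpow_half_sub_one (μ : ℝ) {x : ℝ} (hx : 0 < x) :
    (x / 2) ^ (μ - 1) = (x / 2) ^ μ * (2 / x) := by
  rw [Real.rpow_sub_one (by positivity)]
  field_simp

theorem rpow_half_add_one (μ : ℝ) {x : ℝ} (hx : 0 < x) :
    (x / 2) ^ (μ + 1) = (x / 2) ^ μ * (x / 2) :=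
  Real.rpow_add_one (by positivity) _

theorem besselJ_recurrence (μ : ℝ) {x : ℝ} (hx : 0 < x) :
    besselJ (μ - 1) x + besselJ (μ + 1) x = 2 * μ / x * besselJ μ x := by
  rw [besselJ_eq _ hx, besselJ_eq _ hx, besselJ_eq _ hx, rpow_half_sub_one μ hx,
    rpow_half_add_one μ hx]
  have h := besselA_recurrence μ (x ^ 2 / 4)
  field_simp
  linear_combination 4 * h

theorem besselK_recurrence (μ : ℝ) {x : ℝ} (hx : 0 < x) :
    besselK (μ - 1) x + besselK (μ + 1) x =
      2 * μ / x * besselK μ x + 2 / x * besselJ μ x := by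
  rw [besselJ_eq _ hx, besselK, besselK, besselK, rpow_half_sub_one μ hx,
    rpow_half_add_one μ hx]
  have h := besselA_recurrence μ (x ^ 2 / 4)
  have h' := besselB_recurrence μ (x ^ 2 / 4)
  field_simp
  linear_combination 4 * Real.log (x / 2) * h + 4 * h'

theorem hasDerivAt_rpow_half (μ : ℝ) {x : ℝ} (hx : 0 < x) :
    HasDerivAt (fun t : ℝ => (t / 2) ^ μ) (μ / x * (x / 2) ^ μ) x := by
  have h2 : (0 : ℝ) < x / 2 := by positivity
  refine (((hasDerivAt_id' x).div_const 2).rpow_const (p := μ) (Or.inl h2.ne')).congr_deriv ?_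
  rw [rpow_half_sub_one μ hx]
  ring

theorem hasDerivAt_sq_div_four (x : ℝ) : HasDerivAt (fun t : ℝ => t ^ 2 / 4) (x / 2) x := by
  refine ((hasDerivAt_pow 2 x).div_const 4).congr_deriv ?_
  norm_num
  ring

theorem hasDerivAt_besselJ (μ : ℝ) {x : ℝ} (hx : 0 < x) :
    HasDerivAt (besselJ μ) (μ / x * besselJ μ x - besselJ (μ + 1) x) x := by
  have h := (hasDerivAt_rpow_half μ hx).mul
    ((hasDerivAt_besselA μ (x ^ 2 / 4)).comp x (hasDerivAt_sq_div_four x))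
  have e : besselJ μ =ᶠ[𝓝 x] fun t => (t / 2) ^ μ * besselA μ (t ^ 2 / 4) := by
    filter_upwards [lt_mem_nhds hx] with t ht using besselJ_eq μ ht
  refine (h.congr_of_eventuallyEq e).congr_deriv ?_
  simp only [Function.comp]
  rw [besselJ_eq _ hx, besselJ_eq _ hx, rpow_half_add_one μ hx]
  ring

theorem hasDerivAt_besselK (μ : ℝ) {x : ℝ} (hx : 0 < x) :
    HasDerivAt (besselK μ) (μ / x * besselK μ x + besselJ μ x / x - besselK (μ + 1) x) x := by
  have h2 : (0 : ℝ) < x / 2 := by positivity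
  have hl : HasDerivAt (fun t : ℝ => Real.log (t / 2)) (1 / x) x := by
    refine (((hasDerivAt_id' x).div_const 2).log h2.ne').congr_deriv ?_
    field_simp
  have h := (hasDerivAt_rpow_half μ hx).mul
    ((hl.mul ((hasDerivAt_besselA μ (x ^ 2 / 4)).comp x (hasDerivAt_sq_div_four x))).add
      ((hasDerivAt_besselB μ (x ^ 2 / 4)).comp x (hasDerivAt_sq_div_four x)))
  refine HasDerivAt.congr_deriv (f := besselK μ) h ?_
  simp only [Function.comp, Pi.mul_apply, Pi.add_apply]
  rw [besselJ_eq _ hx, besselK, besselK, rpow_half_add_one μ hx]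
  ring

/-! ### Y at integer and non-integer orders -/

/-- The first k coefficients vanish at the poles of Γ; the rest is a shifted series. -/
theorem besselA_neg_nat (k : ℕ) (y : ℝ) : besselA (-k) y = (-y) ^ k * besselA k y := by
  obtain ⟨M, hM⟩ := exists_bound_coeff (-k)
  have hs := summable_altEGF (fun n => (hM (-k) le_rfl n).1) y
  unfold besselA altEGF
  rw [← hs.sum_add_tsum_nat_add k, Finset.sum_eq_zero, zero_add, ← tsum_mul_left]
  · refine tsum_congr fun n => ?_
    have e1 : ((n + k : ℕ) : ℝ) + -(k : ℝ) = (n : ℕ) := by push_cast; ring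
    have e2 : (n : ℝ) + k = (n + k : ℕ) := by push_cast; ring
    simp only [e1, e2, rGamma_nat, pow_add]
    field_simp
  · intro n hn
    obtain ⟨m, rfl⟩ := Nat.exists_eq_add_of_lt (Finset.mem_range.1 hn)
    have e : (n : ℝ) + -((n + m + 1 : ℕ) : ℝ) = -((m : ℝ) + 1) := by push_cast; ring
    rw [e, rGamma_neg_nat, zero_mul]

theorem besselJ_neg_nat (k : ℕ) {x : ℝ} (hx : 0 < x) :
    besselJ (-k) x = (-1) ^ k * besselJ k x := by
  have h2 : (0 : ℝ) < x / 2 := by positivity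
  rw [besselJ_eq _ hx, besselJ_eq _ hx, besselA_neg_nat, Real.rpow_neg h2.le, Real.rpow_natCast,
    neg_pow, show x ^ 2 / 4 = (x / 2) * (x / 2) by ring, mul_pow]
  field_simp

theorem besselY_eq_quot {ν : ℝ} (h : ¬∃ k : ℤ, ν = (k : ℝ)) (x : ℝ) :
    besselY ν x = besselYQuot ν x := by
  rw [besselY, if_neg h]

/-- L'Hôpital in the order: numerator and denominator both vanish at k, so the quotient equals a
quotient of slopes. -/
theorem tendsto_besselYQuot_nat (k : ℕ) {x : ℝ} (hx : 0 < x) :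
    Tendsto (fun μ => besselYQuot μ x) (𝓝[≠] (k : ℝ))
      (𝓝 ((besselK k x + (-1) ^ k * besselK (-k) x) / Real.pi)) := by
  have hlin : HasDerivAt (fun μ : ℝ => μ * Real.pi) Real.pi k := by
    simpa using (hasDerivAt_id' (k : ℝ)).mul_const Real.pi
  have hN := ((hasDerivAt_besselJ_order k hx).mul hlin.cos).sub
    ((hasDerivAt_besselJ_order (-k) hx).scomp (k : ℝ) (hasDerivAt_neg (k : ℝ)))
  have hD := hlin.sin
  have hpi := Real.pi_ne_zero
  have hsq : ((-1 : ℝ) ^ k) * (-1) ^ k = 1 := by rw [← mul_pow]; norm_num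
  have hne : ((-1 : ℝ) ^ k) ≠ 0 := by positivity
  have h := (hasDerivAt_iff_tendsto_slope.1 hN).div (hasDerivAt_iff_tendsto_slope.1 hD) (by
    rw [Real.cos_nat_mul_pi]
    exact mul_ne_zero hne hpi)
  rw [Real.cos_nat_mul_pi, Real.sin_nat_mul_pi] at h
  have e : (besselK k x * (-1) ^ k + besselJ k x * (-0 * Real.pi) - (-1 : ℝ) • besselK (-k) x) /
      ((-1) ^ k * Real.pi) = (besselK k x + (-1) ^ k * besselK (-k) x) / Real.pi := by
    rw [div_eq_div_iff (mul_ne_zero hne hpi) hpi, smul_eq_mul]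
    linear_combination (-(besselK (-k) x * Real.pi)) * hsq
  rw [e] at h
  refine h.congr' ?_
  filter_upwards [self_mem_nhdsWithin] with μ hμ
  have hμ' : μ - k ≠ 0 := sub_ne_zero.2 hμ
  simp only [Pi.div_apply, slope_def_field, Pi.sub_apply, Pi.mul_apply, Function.comp,
    Real.cos_nat_mul_pi, Real.sin_nat_mul_pi, besselJ_neg_nat k hx]
  rw [div_div_div_cancel_right₀ hμ', besselYQuot]
  ring

theorem besselY_nat (k : ℕ) {x : ℝ} (hx : 0 < x) :
    besselY k x = (besselK k x + (-1) ^ k * besselK (-k) x) / Real.pi := by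
  rw [besselY, if_pos ⟨(k : ℤ), by simp⟩]
  exact (tendsto_besselYQuot_nat k hx).limUnder_eq

theorem eq_nat_or_not_int {ν : ℝ} (hν : 0 ≤ ν) :
    (∃ k : ℕ, ν = k) ∨ ¬∃ k : ℤ, ν = (k : ℝ) := by
  by_cases h : ∃ k : ℤ, ν = (k : ℝ)
  · obtain ⟨k, rfl⟩ := h
    obtain ⟨n, rfl⟩ := Int.eq_ofNat_of_zero_le (by exact_mod_cast hν : 0 ≤ k)
    exact Or.inl ⟨n, by simp⟩
  · exact Or.inr h

theorem not_int_add_one {ν : ℝ} (h : ¬∃ k : ℤ, ν = (k : ℝ)) : ¬∃ k : ℤ, ν + 1 = (k : ℝ) := by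
  rintro ⟨k, hk⟩
  exact h ⟨k - 1, by push_cast; linarith⟩

theorem sin_mul_pi_ne_zero {ν : ℝ} (h : ¬∃ k : ℤ, ν = (k : ℝ)) : Real.sin (ν * Real.pi) ≠ 0 := by
  intro h0
  obtain ⟨k, hk⟩ := Real.sin_eq_zero_iff.1 h0
  exact h ⟨k, (mul_right_cancel₀ Real.pi_ne_zero hk).symm⟩

theorem besselYQuot_add_one (ν x : ℝ) : besselYQuot (ν + 1) x =
    (besselJ (ν + 1) x * Real.cos (ν * Real.pi) + besselJ (-ν - 1) x) / Real.sin (ν * Real.pi) := by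
  rw [besselYQuot, add_mul, one_mul, Real.cos_add_pi, Real.sin_add_pi, div_neg, ← neg_div,
    show -(ν + 1) = -ν - 1 by ring]
  ring

/-- The part of order -ν differentiates to order -ν + 1; the recurrence at -ν moves it to -ν - 1, as
Y_{ν+1} requires. -/
theorem hasDerivAt_besselY {ν : ℝ} (hν : 0 ≤ ν) {x : ℝ} (hx : 0 < x) :
    HasDerivAt (besselY ν) (ν / x * besselY ν x - besselY (ν + 1) x) x := by
  rcases eq_nat_or_not_int hν with ⟨k, rfl⟩ | h
  · have e : besselY k =ᶠ[𝓝 x] fun t => (besselK k t + (-1) ^ k * besselK (-k) t) / Real.pi := by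
      filter_upwards [lt_mem_nhds hx] with t ht using besselY_nat k ht
    have hd := ((hasDerivAt_besselK k hx).add
      ((hasDerivAt_besselK (-k) hx).const_mul ((-1) ^ k))).div_const Real.pi
    refine (hd.congr_of_eventuallyEq e).congr_deriv ?_
    have hr := besselK_recurrence (-k) hx
    have hJ := besselJ_neg_nat k hx
    have hsq : ((-1 : ℝ) ^ k) * (-1) ^ k = 1 := by rw [← mul_pow]; norm_num
    have e1 := besselY_nat (k + 1) hx
    push_cast at e1
    rw [besselY_nat k hx, e1, show -((k : ℝ) + 1) = -k - 1 by ring, hJ]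
    rw [hJ] at hr
    have hpi := Real.pi_ne_zero
    field_simp
    field_simp at hr
    linear_combination (-(-1) ^ k) * hr - besselJ k x * hsq
  · have hd := (((hasDerivAt_besselJ ν hx).mul_const (Real.cos (ν * Real.pi))).sub
      (hasDerivAt_besselJ (-ν) hx)).div_const (Real.sin (ν * Real.pi))
    have e : besselY ν = fun t => (besselJ ν t * Real.cos (ν * Real.pi) - besselJ (-ν) t) /
        Real.sin (ν * Real.pi) := funext fun t => besselY_eq_quot h t
    rw [besselY_eq_quot (not_int_add_one h), besselYQuot_add_one, e]
    refine hd.congr_deriv ?_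
    have hs := sin_mul_pi_ne_zero h
    have hr := besselJ_recurrence (-ν) hx
    field_simp
    field_simp at hr
    linear_combination hr

theorem besselY_recurrence {ν : ℝ} (hν : 0 ≤ ν) {x : ℝ} (hx : 0 < x) :
    besselY ν x + besselY (ν + 2) x = 2 * (ν + 1) / x * besselY (ν + 1) x := by
  have e2 : ν + 2 = ν + 1 + 1 := by ring
  rcases eq_nat_or_not_int hν with ⟨k, rfl⟩ | h
  · have e1 := besselY_nat (k + 1) hx
    have e2 := besselY_nat (k + 2) hx
    have hJ := besselJ_neg_nat (k + 1) hx
    have hr := besselK_recurrence (k + 1) hx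
    have hr' := besselK_recurrence (-(k + 1)) hx
    have hsq : ((-1 : ℝ) ^ k) * (-1) ^ k = 1 := by rw [← mul_pow]; norm_num
    push_cast at e1 e2 hJ
    rw [show (k : ℝ) + 1 - 1 = k by ring, show (k : ℝ) + 1 + 1 = k + 2 by ring] at hr
    rw [show -((k : ℝ) + 1) - 1 = -(k + 2) by ring, show -((k : ℝ) + 1) + 1 = -k by ring, hJ] at hr'
    rw [e1, e2, besselY_nat k hx]
    have hpi := Real.pi_ne_zero
    simp only [pow_succ] at hr' ⊢
    field_simp
    field_simp at hr hr'
    linear_combination hr + (-1) ^ k * hr' - 2 * besselJ (k + 1) x * hsq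
  · have hs := sin_mul_pi_ne_zero h
    have hs' := sin_mul_pi_ne_zero (not_int_add_one h)
    have hr := besselJ_recurrence (ν + 1) hx
    have hr' := besselJ_recurrence (-ν - 1) hx
    rw [show ν + 1 - 1 = ν by ring] at hr
    rw [show -ν - 1 + 1 = -ν by ring] at hr'
    rw [e2, besselY_eq_quot (not_int_add_one (not_int_add_one h)),
      besselY_eq_quot (not_int_add_one h), besselY_eq_quot h, besselYQuot_add_one,
      besselYQuot_add_one, add_mul, one_mul, Real.cos_add_pi, Real.sin_add_pi,
      show -(ν + 1) - 1 = -ν - 1 - 1 by ring, besselYQuot]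
    field_simp
    field_simp at hr hr'
    linear_combination Real.cos (ν * Real.pi) * hr - hr'

/-! ### Behaviour of Y at the origin -/

theorem besselJ_two_mul (μ : ℝ) {t : ℝ} (ht : 0 < t) :
    besselJ μ (2 * t) = t ^ μ * besselA μ (t ^ 2) := by
  rw [besselJ_eq μ (by positivity), show 2 * t / 2 = t by ring,
    show (2 * t) ^ 2 / 4 = t ^ 2 by ring]

theorem besselK_two_mul (μ t : ℝ) :
    besselK μ (2 * t) = t ^ μ * (Real.log t * besselA μ (t ^ 2) + besselB μ (t ^ 2)) := by
  rw [besselK, show 2 * t / 2 = t by ring, show (2 * t) ^ 2 / 4 = t ^ 2 by ring]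

theorem besselA_zero (μ : ℝ) : besselA μ 0 = rGamma μ := by
  rw [besselA, altEGF_zero]
  simp

theorem besselB_zero (μ : ℝ) : besselB μ 0 = deriv rGamma μ := by
  rw [besselB, altEGF_zero]
  simp

theorem tendsto_besselA_sq (μ : ℝ) :
    Tendsto (fun t : ℝ => besselA μ (t ^ 2)) (𝓝[>] 0) (𝓝 (rGamma μ)) := by
  have hc : Continuous fun t : ℝ => besselA μ (t ^ 2) :=
    (continuous_iff_continuousAt.2 fun y => (hasDerivAt_besselA μ y).continuousAt).comp
      (continuous_pow 2)
  have h := hc.tendsto 0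
  rw [zero_pow two_ne_zero, besselA_zero] at h
  exact h.mono_left nhdsWithin_le_nhds

theorem tendsto_besselB_sq (μ : ℝ) :
    Tendsto (fun t : ℝ => besselB μ (t ^ 2)) (𝓝[>] 0) (𝓝 (deriv rGamma μ)) := by
  have hc : Continuous fun t : ℝ => besselB μ (t ^ 2) :=
    (continuous_iff_continuousAt.2 fun y => (hasDerivAt_besselB μ y).continuousAt).comp
      (continuous_pow 2)
  have h := hc.tendsto 0
  rw [zero_pow two_ne_zero, besselB_zero] at h
  exact h.mono_left nhdsWithin_le_nhds

theorem tendsto_rpow_zero {p : ℝ} (hp : 0 < p) :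
    Tendsto (fun t : ℝ => t ^ p) (𝓝[>] 0) (𝓝 0) := by
  have h := (Real.continuous_rpow_const hp.le).tendsto 0
  rw [Real.zero_rpow hp.ne'] at h
  exact h.mono_left nhdsWithin_le_nhds

/-- For non-integer ν the term J_{-ν} dominates, and the reflection formula evaluates its
coefficient. For integer ν the logarithm is killed by t^(2k), leaving the derivative of 1/Γ at -k.
-/
theorem tendsto_rpow_mul_besselY {ν : ℝ} (hν : 0 < ν) :
    Tendsto (fun t : ℝ => t ^ ν * besselY ν (2 * t)) (𝓝[>] 0) (𝓝 (-Real.Gamma ν / Real.pi)) := by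
  rcases eq_nat_or_not_int hν.le with ⟨k, rfl⟩ | h
  · obtain ⟨m, rfl⟩ : ∃ m, k = m + 1 := Nat.exists_eq_succ_of_ne_zero (by
      rintro rfl; simp at hν)
    set k := m + 1 with hk
    have h2 : (0 : ℝ) < ((2 * k : ℕ) : ℝ) := by positivity
    have hsq : ((-1 : ℝ) ^ k) * (-1) ^ k = 1 := by rw [← mul_pow]; norm_num
    have hl := (tendsto_log_mul_rpow_nhdsGT_zero h2).mul (tendsto_besselA_sq k)
    have hp := (tendsto_rpow_zero h2).mul (tendsto_besselB_sq k)
    have hB := (tendsto_besselB_sq (-k)).const_mul ((-1 : ℝ) ^ k)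
    -- The factor 2 arises because the logarithmic terms of K_k and (-1)^k K_{-k} coincide by
    -- `besselA_neg_nat`.
    have hlim := (((hl.const_mul 2).add hp).add hB).div_const Real.pi
    have e : (2 * (0 * rGamma k) + 0 * deriv rGamma k + (-1) ^ k * deriv rGamma (-k)) / Real.pi =
        -Real.Gamma k / Real.pi := by
      have e1 := deriv_rGamma_neg_nat m
      have e2 := Real.Gamma_nat_eq_factorial m
      have hsq' : ((-1 : ℝ) ^ m) * (-1) ^ m = 1 := by rw [← mul_pow]; norm_num
      rw [hk]
      push_cast
      rw [e1, e2, pow_succ]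
      congr 1
      linear_combination (-(m.factorial : ℝ)) * hsq'
    rw [e] at hlim
    refine hlim.congr' ?_
    filter_upwards [self_mem_nhdsWithin] with t ht
    have ht : 0 < t := ht
    rw [besselY_nat k (by positivity), besselK_two_mul, besselK_two_mul, besselA_neg_nat,
      Real.rpow_neg ht.le, Real.rpow_natCast, Real.rpow_natCast, neg_pow, pow_mul, ← pow_mul,
      mul_comm 2 k, pow_mul]
    have hpi := Real.pi_ne_zero
    field_simp
    linear_combination (-(t ^ k) ^ 2 * Real.log t * besselA k (t ^ 2)) * hsq
  · have hs := sin_mul_pi_ne_zero h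
    have hJ := ((tendsto_rpow_zero hν).mul (tendsto_rpow_zero hν)).mul (tendsto_besselA_sq ν)
    have hlim := ((hJ.mul_const (Real.cos (ν * Real.pi))).sub (tendsto_besselA_sq (-ν))).div_const
      (Real.sin (ν * Real.pi))
    have e : (0 * 0 * rGamma ν * Real.cos (ν * Real.pi) - rGamma (-ν)) / Real.sin (ν * Real.pi) =
        -Real.Gamma ν / Real.pi := by
      have hr := Real.Gamma_mul_Gamma_one_sub ν
      rw [mul_comm Real.pi ν] at hr
      have hne : Real.Gamma (1 - ν) ≠ 0 := by
        intro h0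
        rw [h0, mul_zero] at hr
        exact div_ne_zero Real.pi_ne_zero hs hr.symm
      have hpi := Real.pi_ne_zero
      rw [show rGamma (-ν) = (Real.Gamma (1 - ν))⁻¹ by rw [rGamma, neg_add_eq_sub]]
      field_simp at hr ⊢
      linear_combination hr
    rw [e] at hlim
    refine hlim.congr' ?_
    filter_upwards [self_mem_nhdsWithin] with t ht
    have ht : 0 < t := ht
    rw [besselY_eq_quot h, besselYQuot, besselJ_two_mul _ ht, besselJ_two_mul _ ht,
      Real.rpow_neg ht.le]
    have hne : t ^ ν ≠ 0 := (Real.rpow_pos_of_pos ht ν).ne'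
    field_simp

/-! ### Monotonicity of x²Δ -/

theorem hasDerivAt_besselY_add_one {ν : ℝ} (hν : 0 ≤ ν) {x : ℝ} (hx : 0 < x) :
    HasDerivAt (besselY (ν + 1)) (besselY ν x - (ν + 1) / x * besselY (ν + 1) x) x := by
  refine (hasDerivAt_besselY (by linarith : 0 ≤ ν + 1) hx).congr_deriv ?_
  rw [show ν + 1 + 1 = ν + 2 by ring]
  have h := besselY_recurrence hν hx
  field_simp
  field_simp at h
  linear_combination -h

theorem turanY_eq {ν : ℝ} (hν : 1 ≤ ν) {x : ℝ} (hx : 0 < x) :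
    turanY ν x = besselY ν x ^ 2 + besselY (ν + 1) x ^ 2 -
      2 * ν / x * (besselY ν x * besselY (ν + 1) x) := by
  have h := besselY_recurrence (by linarith : 0 ≤ ν - 1) hx
  rw [show ν - 1 + 2 = ν + 1 by ring, sub_add_cancel] at h
  rw [turanY, eq_sub_of_add_eq h]
  ring

theorem hasDerivAt_sq_mul_turanY {ν : ℝ} (hν : 1 ≤ ν) {x : ℝ} (hx : 0 < x) :
    HasDerivAt (fun t => t ^ 2 * turanY ν t) (2 * x * besselY ν x ^ 2) x := by
  have hν0 : 0 ≤ ν := by linarith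
  have hu := hasDerivAt_besselY hν0 hx
  have hv := hasDerivAt_besselY_add_one hν0 hx
  have e : (fun t => t ^ 2 * turanY ν t) =ᶠ[𝓝 x] fun t =>
      t ^ 2 * (besselY ν t ^ 2 + besselY (ν + 1) t ^ 2) -
        2 * ν * t * (besselY ν t * besselY (ν + 1) t) := by
    filter_upwards [lt_mem_nhds hx] with t ht
    rw [turanY_eq hν ht]
    have := ht.ne'
    field_simp
  have hd := ((hasDerivAt_pow 2 x).mul ((hu.fun_pow 2).add (hv.fun_pow 2))).sub
    (((hasDerivAt_id' x).const_mul (2 * ν)).mul (hu.mul hv))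
  refine (hd.congr_of_eventuallyEq e).congr_deriv ?_
  simp only [Pi.add_apply, Pi.mul_apply]
  push_cast
  field_simp
  ring

theorem monotoneOn_sq_mul_turanY {ν : ℝ} (hν : 1 ≤ ν) :
    MonotoneOn (fun t => t ^ 2 * turanY ν t) (Set.Ioi 0) := by
  refine monotoneOn_of_deriv_nonneg (convex_Ioi 0)
    (fun x hx => (hasDerivAt_sq_mul_turanY hν hx).continuousAt.continuousWithinAt)
    (fun x hx => ?_) (fun x hx => ?_) <;> rw [interior_Ioi] at hx
  · exact (hasDerivAt_sq_mul_turanY hν hx).differentiableAt.differentiableWithinAt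
  · rw [(hasDerivAt_sq_mul_turanY hν hx).deriv]
    have : (0 : ℝ) < x := hx
    positivity

/-! ### No common zero of Y_ν and Y_{ν+1} -/

theorem hasDerivAt_besselY_energy {ν : ℝ} (hν : 0 ≤ ν) {x : ℝ} (hx : 0 < x) :
    HasDerivAt (fun t => besselY ν t ^ 2 + besselY (ν + 1) t ^ 2)
      (2 * ν / x * besselY ν x ^ 2 - 2 * (ν + 1) / x * besselY (ν + 1) x ^ 2) x := by
  refine (((hasDerivAt_besselY hν hx).fun_pow 2).add
    ((hasDerivAt_besselY_add_one hν hx).fun_pow 2)).congr_deriv ?_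
  push_cast
  ring

theorem hasDerivAt_rpow_mul_energy {ν : ℝ} (hν : 0 ≤ ν) (p : ℝ) {x : ℝ} (hx : 0 < x) :
    HasDerivAt (fun t => t ^ p * (besselY ν t ^ 2 + besselY (ν + 1) t ^ 2))
      (x ^ p / x * ((p + 2 * ν) * besselY ν x ^ 2 +
        (p - 2 * (ν + 1)) * besselY (ν + 1) x ^ 2)) x := by
  refine ((Real.hasDerivAt_rpow_const (p := p) (Or.inl hx.ne')).mul
    (hasDerivAt_besselY_energy hν hx)).congr_deriv ?_
  rw [Real.rpow_sub_one hx.ne']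
  field_simp
  ring

theorem monotoneOn_rpow_mul_energy {ν : ℝ} (hν : 0 ≤ ν) :
    MonotoneOn (fun t => t ^ (2 * (ν + 1)) * (besselY ν t ^ 2 + besselY (ν + 1) t ^ 2))
      (Set.Ioi 0) := by
  refine monotoneOn_of_deriv_nonneg (convex_Ioi 0)
    (fun x hx => (hasDerivAt_rpow_mul_energy hν _ hx).continuousAt.continuousWithinAt)
    (fun x hx => ?_) (fun x hx => ?_) <;> rw [interior_Ioi] at hx
  · exact (hasDerivAt_rpow_mul_energy hν _ hx).differentiableAt.differentiableWithinAt
  · rw [(hasDerivAt_rpow_mul_energy hν _ hx).deriv, sub_self, zero_mul, add_zero]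
    have : (0 : ℝ) < x := hx
    positivity

theorem antitoneOn_rpow_mul_energy {ν : ℝ} (hν : 0 ≤ ν) :
    AntitoneOn (fun t => t ^ (-(2 * ν)) * (besselY ν t ^ 2 + besselY (ν + 1) t ^ 2))
      (Set.Ioi 0) := by
  refine antitoneOn_of_deriv_nonpos (convex_Ioi 0)
    (fun x hx => (hasDerivAt_rpow_mul_energy hν _ hx).continuousAt.continuousWithinAt)
    (fun x hx => ?_) (fun x hx => ?_) <;> rw [interior_Ioi] at hx
  · exact (hasDerivAt_rpow_mul_energy hν _ hx).differentiableAt.differentiableWithinAt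
  · rw [(hasDerivAt_rpow_mul_energy hν _ hx).deriv, neg_add_cancel, zero_mul, zero_add]
    have : (0 : ℝ) < x := hx
    refine mul_nonpos_of_nonneg_of_nonpos (by positivity)
      (mul_nonpos_of_nonpos_of_nonneg (by linarith) (sq_nonneg _))

/-- Uniqueness for the linear system of (Y_ν, Y_{ν+1}) without ODE theory: the two weighted
monotonicities carry positivity to the right and to the left. -/
theorem energy_pos_of_energy_pos {ν : ℝ} (hν : 0 ≤ ν) {a x : ℝ} (ha : 0 < a) (hx : 0 < x)
    (h : 0 < besselY ν a ^ 2 + besselY (ν + 1) a ^ 2) :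
    0 < besselY ν x ^ 2 + besselY (ν + 1) x ^ 2 := by
  rcases le_total a x with hax | hxa
  · have hm := monotoneOn_rpow_mul_energy hν ha hx hax
    exact pos_of_mul_pos_right ((mul_pos (Real.rpow_pos_of_pos ha _) h).trans_le hm)
      (Real.rpow_pos_of_pos hx _).le
  · have hm := antitoneOn_rpow_mul_energy hν hx ha hxa
    exact pos_of_mul_pos_right ((mul_pos (Real.rpow_pos_of_pos ha _) h).trans_le hm)
      (Real.rpow_pos_of_pos hx _).le

/-! ### Sign of Δ, strict growth and the root -/

theorem Gamma_sq_lt {ν : ℝ} (hν : 1 < ν) :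
    Real.Gamma ν ^ 2 < Real.Gamma (ν - 1) * Real.Gamma (ν + 1) := by
  have h1 : Real.Gamma ν = (ν - 1) * Real.Gamma (ν - 1) := by
    rw [← Real.Gamma_add_one (by linarith), sub_add_cancel]
  have h2 := Real.Gamma_add_one (show ν ≠ 0 by linarith)
  have hpos := Real.Gamma_pos_of_pos (show 0 < ν - 1 by linarith)
  rw [h2, h1]
  nlinarith [mul_pos hpos hpos]

theorem exists_turanY_neg {ν : ℝ} (hν : 1 < ν) : ∃ x, 0 < x ∧ x < ν ∧ turanY ν x < 0 := by
  have h0 := tendsto_rpow_mul_besselY (show 0 < ν by linarith)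
  have h1 := tendsto_rpow_mul_besselY (show 0 < ν - 1 by linarith)
  have h2 := tendsto_rpow_mul_besselY (show 0 < ν + 1 by linarith)
  have hlim := (h0.pow 2).sub (h1.mul h2)
  have hneg : (-Real.Gamma ν / Real.pi) ^ 2 -
      -Real.Gamma (ν - 1) / Real.pi * (-Real.Gamma (ν + 1) / Real.pi) < 0 := by
    have e : (-Real.Gamma ν / Real.pi) ^ 2 -
        -Real.Gamma (ν - 1) / Real.pi * (-Real.Gamma (ν + 1) / Real.pi) =
        (Real.Gamma ν ^ 2 - Real.Gamma (ν - 1) * Real.Gamma (ν + 1)) / Real.pi ^ 2 := by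
      have := Real.pi_ne_zero
      field_simp
    rw [e]
    exact div_neg_of_neg_of_pos (sub_neg.2 (Gamma_sq_lt hν)) (by positivity)
  -- The limits concern the argument 2t, so t < ν/2 keeps the point below ν.
  have hν2 : (0 : ℝ) < ν / 2 := by linarith
  obtain ⟨t, ht, ht0, htν⟩ := ((hlim.eventually_lt_const hneg).and
    (Ioo_mem_nhdsGT hν2)).exists
  refine ⟨2 * t, by linarith, by linarith, ?_⟩
  rw [Real.rpow_sub_one ht0.ne', Real.rpow_add_one ht0.ne'] at ht
  have e : (t ^ ν * besselY ν (2 * t)) ^ 2 - t ^ ν / t * besselY (ν - 1) (2 * t) *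
      (t ^ ν * t * besselY (ν + 1) (2 * t)) = (t ^ ν) ^ 2 * turanY ν (2 * t) := by
    rw [turanY]
    have := ht0.ne'
    field_simp
  rw [e] at ht
  exact neg_of_mul_neg_right ht (by positivity)

/-- If both functions vanished at a point where Δ < 0, Δ would be 0 there. -/
theorem energy_pos {ν : ℝ} (hν : 1 < ν) {x : ℝ} (hx : 0 < x) :
    0 < besselY ν x ^ 2 + besselY (ν + 1) x ^ 2 := by
  obtain ⟨a, ha, -, hneg⟩ := exists_turanY_neg hν
  refine energy_pos_of_energy_pos (by linarith) ha hx ?_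
  by_contra! h
  have hu : besselY ν a = 0 := by nlinarith [sq_nonneg (besselY ν a), sq_nonneg (besselY (ν + 1) a)]
  have hv : besselY (ν + 1) a = 0 := by
    nlinarith [sq_nonneg (besselY ν a), sq_nonneg (besselY (ν + 1) a)]
  rw [turanY_eq hν.le ha, hu, hv] at hneg
  simp at hneg

theorem strictMonoOn_sq_mul_turanY {ν : ℝ} (hν : 1 < ν) :
    StrictMonoOn (fun t => t ^ 2 * turanY ν t) (Set.Ioi 0) := by
  intro a ha b hb hab
  have hm := monotoneOn_sq_mul_turanY hν.le
  refine lt_of_le_of_ne (hm ha hb hab.le) fun heq => ?_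
  -- Equal end values force x²Δ to be constant on (a, b), hence Y_ν = 0 there, and its derivative
  -- formula yields Y_{ν+1} = 0.
  have hpos : ∀ t ∈ Set.Ioo a b, 0 < t := fun t ht => lt_trans ha ht.1
  have hu : ∀ t ∈ Set.Ioo a b, besselY ν t = 0 := by
    intro t ht
    have hc : (fun s => s ^ 2 * turanY ν s) =ᶠ[𝓝 t] fun _ => a ^ 2 * turanY ν a := by
      filter_upwards [Ioo_mem_nhds ht.1 ht.2] with s hs
      exact le_antisymm ((hm (hpos s hs) hb hs.2.le).trans heq.ge) (hm ha (hpos s hs) hs.1.le)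
    have h := (hasDerivAt_sq_mul_turanY hν.le (hpos t ht)).unique
      ((hasDerivAt_const t _).congr_of_eventuallyEq hc)
    have := hpos t ht
    simpa [this.ne'] using h
  obtain ⟨t, ht⟩ := exists_between hab
  have hut : besselY ν =ᶠ[𝓝 t] fun _ => 0 := by
    filter_upwards [Ioo_mem_nhds ht.1 ht.2] with s hs using hu s hs
  have h := (hasDerivAt_besselY (by linarith : 0 ≤ ν) (hpos t ht)).unique
    ((hasDerivAt_const t _).congr_of_eventuallyEq hut)
  have hE := energy_pos hν (hpos t ht)
  rw [hu t ht, mul_zero, zero_sub, neg_eq_zero] at h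
  rw [hu t ht, h] at hE
  simp at hE

theorem turanY_self_nonneg {ν : ℝ} (hν : 1 < ν) : 0 ≤ turanY ν ν := by
  have h0 : ν ≠ 0 := by linarith
  rw [turanY_eq hν.le (by linarith), mul_div_assoc, div_self h0]
  nlinarith [sq_nonneg (besselY ν ν - besselY (ν + 1) ν)]

theorem exists_turanY_eq_zero {ν : ℝ} (hν : 1 < ν) : ∃ x, 0 < x ∧ x ≤ ν ∧ turanY ν x = 0 := by
  obtain ⟨a, ha, haν, hneg⟩ := exists_turanY_neg hν
  have hν0 : 0 < ν := by linarith
  have hc : ContinuousOn (fun t => t ^ 2 * turanY ν t) (Set.Icc a ν) := fun x hx =>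
    (hasDerivAt_sq_mul_turanY hν.le (ha.trans_le hx.1)).continuousAt.continuousWithinAt
  obtain ⟨x, hx, h⟩ := intermediate_value_Icc haν.le hc (show (0 : ℝ) ∈ _ from
    ⟨mul_nonpos_of_nonneg_of_nonpos (sq_nonneg a) hneg.le,
      mul_nonneg (sq_nonneg ν) (turanY_self_nonneg hν)⟩)
  have hx0 : 0 < x := ha.trans_le hx.1
  exact ⟨x, hx0, hx.2, (mul_eq_zero.1 h).resolve_left (by positivity)⟩

theorem theorem5p1 (ν : ℝ) (hν : 1 < ν) :
    ∃ xν : ℝ, 0 < xν ∧ xν ≤ ν ∧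
      turanY ν xν = 0 ∧
      (∀ x : ℝ, 0 < x → turanY ν x = 0 → x = xν) ∧
      (∀ x : ℝ, xν < x → 0 < turanY ν x) ∧
      (∀ x : ℝ, 0 < x → x < xν → turanY ν x < 0) ∧
      (∀ x : ℝ, xν ≤ x → 1 / (1 - ν) * besselY ν x ^ 2 < turanY ν x) ∧
      (∃ c : ℝ, 1 / (1 - ν) < c ∧ ∀ x : ℝ, xν ≤ x → c * besselY ν x ^ 2 < turanY ν x) := by
  obtain ⟨r, hr, hrν, h0⟩ := exists_turanY_eq_zero hν
  have hmono := strictMonoOn_sq_mul_turanY hν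
  have hpos : ∀ x, r < x → 0 < turanY ν x := by
    intro x hx
    have h := hmono hr (hr.trans hx) hx
    simp only [h0, mul_zero] at h
    exact pos_of_mul_pos_right h (sq_nonneg x)
  have hneg : ∀ x, 0 < x → x < r → turanY ν x < 0 := by
    intro x hx hxr
    have h := hmono hx hr hxr
    simp only [h0, mul_zero] at h
    exact neg_of_mul_neg_right h (sq_nonneg x)
  -- If Y_ν vanished at the root, Δ would reduce to Y_{ν+1}², which is positive.
  have hY : 0 < besselY ν r ^ 2 := by
    have hE := energy_pos hν hr
    rw [turanY_eq hν.le hr] at h0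
    refine sq_pos_of_ne_zero ?_
    intro hu
    rw [hu] at h0 hE
    simp only [zero_mul, mul_zero, sub_zero] at h0
    exact hE.ne' h0
  have hc : ∀ c < 0, ∀ x, r ≤ x → c * besselY ν x ^ 2 < turanY ν x := by
    intro c hc x hx
    rcases hx.eq_or_lt with rfl | hx
    · rw [h0]
      exact mul_neg_of_neg_of_pos hc hY
    · exact (mul_nonpos_of_nonpos_of_nonneg hc.le (sq_nonneg _)).trans_lt (hpos x hx)
  have hconst : 1 / (1 - ν) < 0 := one_div_neg.2 (by linarith)
  -- Halving the negative number 1/(1-ν) gives a larger constant that is still negative.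
  refine ⟨r, hr, hrν, h0, ?_, hpos, hneg, hc _ hconst, 1 / (1 - ν) / 2, by linarith,
    hc _ (by linarith)⟩
  intro x hx hx0
  rcases lt_trichotomy x r with h | h | h
  · exact absurd hx0 (hneg x hx h).ne
  · exact h
  · exact absurd hx0 (hpos x h).ne'
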